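/- **Theorem 3 (Exponential Decay of Sensitivity).** Let $N\ge 1$ and $n_x,n_u,n_w\ge 0$ be integers with $n:=n_x+n_u\ge 1$, and put $m:=4n_x+2n_u+2n_w$. Let $A_i\in\mathbb{R}^{n_x\times n_x}$, $B_i\in\mathbb{R}^{n_x\times n_u}$, $E_i\in\mathbb{R}^{n_w\times n_x}$, $F_i\in\mathbb{R}^{n_w\times n_u}$ ($1\le i\le N$) and $\boldsymbol{p}\in\mathbb{R}^{nN}$ be given. Consider the model predictive control problem with states $x_i$, controls $u_i$, dynamics $x_1=v_1$, $x_i=A_{i-1}x_{i-1}+B_{i-1}u_{i-1}+v_i$ ($2\le i\le N$), constraints $E_ix_i+F_iu_i=w_i$, $\underline{x}_i\le x_i\le\overline{x}_i$, $\underline{u}_i\le u_i\le\overline{u}_i$ ($1\le i\le N$), and a linear cost, in its LP form: with $z_i=(x_i,u_i)\in\mathbb{R}^n$, $\boldsymbol{z}=(z_1,\dots,z_N)$ and $\boldsymbol{d}=(d_1,\dots,d_N)$, $d_i\in\mathbb{R}^m$ (for the MPC problem, $d_i=(v_i,-v_i,w_i,-w_i,\underline{x}_i,-\overline{x}_i,\underline{u}_i,-\overline{u}_i)$),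 it is $$P(\boldsymbol{d}):\qquad \min_{\boldsymbol{z}\in\mathbb{R}^{nN}}\ \boldsymbol{p}^\top\boldsymbol{z}\quad\text{subject to}\quad \boldsymbol{G}\boldsymbol{z}\ge\boldsymbol{d},$$ where $\boldsymbol{G}\in\mathbb{R}^{mN\times nN}$ has the $m\times n$ blocks $$G_{i,i}=\begin{bmatrix} I&0\\-I&0\\E_i&F_i\\-E_i&-F_i\\I&0\\-I&0\\0&I\\0&-I\end{bmatrix},\qquad G_{i,i-1}=\begin{bmatrix}-A_{i-1}&-B_{i-1}\\A_{i-1}&B_{i-1}\\0&0\\0&0\\0&0\\0&0\\0&0\\0&0\end{bmatrix},$$ and $G_{i,j}=0$ unless $0\le i-j\le 1$. Let $\mathbb{D}$ be the set of all admissible data vectors, i.e. of all $\boldsymbol{d}\in\mathbb{R}^{mN}$ for which $P(\boldsymbol{d})$ is feasible. A set $B\subseteq\{1,\dots,mN\}$ is a basis if the row submatrix $\boldsymbol{G}[B,:]$ is square and non-singular; a basis $B$ is optimal for $P(\boldsymbol{d})$ if the unique $\boldsymbol{z}$ with $\boldsymbol{G}[B,:]\boldsymbol{z}=\boldsymbol{d}[B]$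 is an optimal solution of $P(\boldsymbol{d})$. Let $\mathbb{B}$ be the collection of all sets $B$ that are an optimal basis for $P(\boldsymbol{d})$ for some $\boldsymbol{d}\in\mathbb{D}$. Then $\underline{\sigma}:=\min_{B\in\mathbb{B}}\sigma_{\min}(\boldsymbol{G}[B,:])$ and $\overline{\sigma}:=\max_{B\in\mathbb{B}}\sigma_{\max}(\boldsymbol{G}[B,:])$ (minimum and maximum of the smallest and of the largest singular value) exist, $\underline{\sigma}>0$, and with $$\Gamma:=\frac{\overline{\sigma}}{\underline{\sigma}^2},\qquad \rho:=\frac{\overline{\sigma}^2-\underline{\sigma}^2}{\overline{\sigma}^2+\underline{\sigma}^2}$$ the following holds. For any $\boldsymbol{d},\boldsymbol{d}'\in\mathbb{D}$ there are an optimal solution $\boldsymbol{z}^*(\boldsymbol{d})$ of $P(\boldsymbol{d})$ and an optimal solution $\boldsymbol{z}^*(\boldsymbol{d}')$ of $P(\boldsymbol{d}')$ such that, for every $i\in\{1,\dots,N\}$, $$\|z^*_i(\boldsymbol{d})-z^*_i(\boldsymbol{d}')\|\le\sum_{j=1}^N\Gamma\,\rho^{(|i-j|-1)_+}\,\|d_j-d'_j\|,$$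 where $\|\cdot\|$ is the Euclidean norm, $(a)_+=\max(0,a)$ and $0^0=1$. -/

import Mathlib

open scoped Matrix

noncomputable section

/-- Index set of one stage variable `z_i = (x_i, u_i)`; it has `n = nx + nu` elements. -/
abbrev StageCol (nx nu : ℕ) : Type := Fin nx ⊕ Fin nu

/-- Index set of the constraints of one stage, in the order of
`d_i = (v_i, -v_i, w_i, -w_i, xlo_i, -xhi_i, ulo_i, -uhi_i)`; it has
`m = 4 nx + 2 nu + 2 nw` elements. -/
abbrev StageRow (nx nu nw : ℕ) : Type :=
  Fin nx ⊕ Fin nx ⊕ Fin nw ⊕ Fin nw ⊕ Fin nx ⊕ Fin nx ⊕ Fin nu ⊕ Fin nu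

/-- The diagonal block `G_{i,i}`, built from `E_i` and `F_i`. -/
def diagBlock {nx nu nw : ℕ} (E : Matrix (Fin nw) (Fin nx) ℝ) (F : Matrix (Fin nw) (Fin nu) ℝ) :
    Matrix (StageRow nx nu nw) (StageCol nx nu) ℝ :=
  Matrix.fromRows (Matrix.fromCols 1 0) <|
  Matrix.fromRows (Matrix.fromCols (-1) 0) <|
  Matrix.fromRows (Matrix.fromCols E F) <|
  Matrix.fromRows (Matrix.fromCols (-E) (-F)) <|
  Matrix.fromRows (Matrix.fromCols 1 0) <|
  Matrix.fromRows (Matrix.fromCols (-1) 0) <|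
  Matrix.fromRows (Matrix.fromCols 0 1) (Matrix.fromCols 0 (-1))

/-- The subdiagonal block `G_{i,i-1}`, built from `A_{i-1}` and `B_{i-1}`. -/
def subdiagBlock {nx nu : ℕ} (nw : ℕ) (A : Matrix (Fin nx) (Fin nx) ℝ)
    (B : Matrix (Fin nx) (Fin nu) ℝ) : Matrix (StageRow nx nu nw) (StageCol nx nu) ℝ :=
  Matrix.fromRows (Matrix.fromCols (-A) (-B)) <|
  Matrix.fromRows (Matrix.fromCols A B) 0

/-- The constraint matrix `G` of the MPC problem in LP form: block `(i, i)` is `diagBlock`,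
block `(i, i-1)` is `subdiagBlock`, all the others vanish. The stages `1, …, N` are numbered
`0, …, N-1`; the last matrices `A`, `B` do not enter. -/
def mpcMatrix {N nx nu nw : ℕ} (A : Fin N → Matrix (Fin nx) (Fin nx) ℝ)
    (B : Fin N → Matrix (Fin nx) (Fin nu) ℝ) (E : Fin N → Matrix (Fin nw) (Fin nx) ℝ)
    (F : Fin N → Matrix (Fin nw) (Fin nu) ℝ) :
    Matrix (Fin N × StageRow nx nu nw) (Fin N × StageCol nx nu) ℝ :=
  Matrix.of fun r c =>
    if r.1 = c.1 then diagBlock (E r.1) (F r.1) r.2 c.2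
    else if (r.1 : ℕ) = (c.1 : ℕ) + 1 then subdiagBlock nw (A c.1) (B c.1) r.2 c.2
    else 0

section LinearProgram

variable {R C : Type*} [Fintype R] [Fintype C] [DecidableEq C]

/-- `z` is feasible for the linear program `P(d)`: minimize `pᵀ z` subject to `G z ≥ d`. -/
def IsFeasible (G : Matrix R C ℝ) (d : R → ℝ) (z : C → ℝ) : Prop :=
  ∀ r, d r ≤ (G *ᵥ z) r

/-- `z` is a solution (an optimal point) of `P(d)`. -/
def IsSolution (G : Matrix R C ℝ) (p : C → ℝ) (d : R → ℝ) (z : C → ℝ) : Prop :=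
  IsFeasible G d z ∧ ∀ y, IsFeasible G d y → p ⬝ᵥ z ≤ p ⬝ᵥ y

/-- The set `𝔻` of admissible data: those `d` for which `P(d)` is feasible. -/
def admissibleData (G : Matrix R C ℝ) : Set (R → ℝ) :=
  {d | ∃ z, IsFeasible G d z}

/-- The row submatrix `G[B,:]`. -/
def rowsOf (G : Matrix R C ℝ) (B : Finset R) : Matrix B C ℝ :=
  G.submatrix (fun r : B => (r : R)) id

/-- `B` is a basis: `G[B,:]` is square and non-singular, i.e. it acts bijectively on vectors. -/
def IsBasis (G : Matrix R C ℝ) (B : Finset R) : Prop :=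
  Function.Bijective fun z : C → ℝ => rowsOf G B *ᵥ z

/-- `B` is an optimal basis for `P(d)`: a basis whose basic solution, i.e. the unique `z` with
`G[B,:] z = d[B]`, is a solution of `P(d)`. -/
def IsOptimalBasis (G : Matrix R C ℝ) (p : C → ℝ) (d : R → ℝ) (B : Finset R) : Prop :=
  IsBasis G B ∧ ∃ z : C → ℝ, (∀ r : B, (rowsOf G B *ᵥ z) r = d r) ∧ IsSolution G p d z

/-- The collection `𝔹` of the sets that are an optimal basis for some admissible data vector. -/
def optimalBases (G : Matrix R C ℝ) (p : C → ℝ) : Set (Finset R) :=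
  {B | ∃ d ∈ admissibleData G, IsOptimalBasis G p d B}

/-- Largest singular value of a matrix (Mathlib lists singular values in descending order). -/
def sigmaMax (M : Matrix R C ℝ) : ℝ :=
  (Matrix.toEuclideanLin M).singularValues 0

/-- Smallest singular value of a square matrix (more generally, of a matrix with at least as many
rows as columns), the last one in the descending list of the `|C|` singular values. -/
def sigmaMin (M : Matrix R C ℝ) : ℝ :=
  (Matrix.toEuclideanLin M).singularValues (Fintype.card C - 1)

/-- The minimum of `σ_min(G[B,:])` over the optimal bases `B`. -/
def sigmaLower (G : Matrix R C ℝ) (p : C → ℝ) : ℝ :=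
  sInf ((fun B => sigmaMin (rowsOf G B)) '' optimalBases G p)

/-- The maximum of `σ_max(G[B,:])` over the optimal bases `B`. -/
def sigmaUpper (G : Matrix R C ℝ) (p : C → ℝ) : ℝ :=
  sSup ((fun B => sigmaMax (rowsOf G B)) '' optimalBases G p)

/-- The constant `Γ`. -/
def sensConst (G : Matrix R C ℝ) (p : C → ℝ) : ℝ :=
  sigmaUpper G p / sigmaLower G p ^ 2

/-- The decay rate `ρ`. -/
def sensRate (G : Matrix R C ℝ) (p : C → ℝ) : ℝ :=
  (sigmaUpper G p ^ 2 - sigmaLower G p ^ 2) / (sigmaUpper G p ^ 2 + sigmaLower G p ^ 2)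

end LinearProgram

/-- The block `v_i` of a stacked vector `v = (v_1, …, v_N)`, with its Euclidean norm. -/
def stage {N : ℕ} {ι : Type*} (v : Fin N × ι → ℝ) (i : Fin N) : EuclideanSpace ℝ ι :=
  WithLp.toLp 2 fun k => v (i, k)

end

/-! Two facts combine. For one basis, the response to a data change on stage `j` solves a block
bidiagonal system `M w = δ`. Richardson iteration on the normal equations reaches one more stage per
iteration and contracts the error by `ρ`. The iterate just before stage `i` is reached vanishes
there, so `w` at stage `i` is pure iteration error (`sum_sq_le_of_mulVec_supported`,
`norm_stage_le_of_isBasis`). To pass from bases to optimal solutions, the cost is perturbed so that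
every optimal point is unique and basic with positive multipliers, while still solving the original
program (`exists_isGenericCost`). Along the segment from `d'` to `d` this solution is affine on each
of finitely many closed sets, one per basis, and the bounds on the pieces glue together
(`norm_sub_le_of_finite_closed_cover`, `exists_isSolution_sub_le_of_basis_bound`). The box
constraints make `0` the only feasible point for zero data. Every basis is then optimal for zero
data, so the constants control all bases that occur. -/

/-! ### Finitely generated cones -/

/-- **Farkas' lemma** for finitely many linear functionals. -/
theorem farkas_linear_functionals {ι V : Type*} [AddCommGroup V] [Module ℝ V] (s : Finset ι)
    (a : ι → V →ₗ[ℝ] ℝ) (f : V →ₗ[ℝ] ℝ) (h : ∀ y, (∀ i ∈ s, 0 ≤ a i y) → 0 ≤ f y) :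
    ∃ l : ι → ℝ, (∀ i, 0 ≤ l i) ∧ f = ∑ i ∈ s, l i • a i := by
  classical
  induction s using Finset.induction_on generalizing a f with
  | empty =>
    refine ⟨0, fun _ => le_rfl, ?_⟩
    ext y
    have h1 := h y (by simp)
    have h2 := h (-y) (by simp)
    rw [map_neg] at h2
    simp only [Finset.sum_empty, LinearMap.zero_apply]
    linarith
  | insert j s hj ih =>
    by_cases hs : ∀ y, (∀ i ∈ s, 0 ≤ a i y) → 0 ≤ f y
    · obtain ⟨l, hl, rfl⟩ := ih a f hs
      refine ⟨Function.update l j 0, fun i => ?_, ?_⟩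
      · by_cases hi : i = j
        · simp [hi]
        · simpa [hi] using hl i
      · rw [Finset.sum_insert hj]
        simp only [Function.update_self, zero_smul, zero_add]
        refine Finset.sum_congr rfl fun i hi => ?_
        rw [Function.update_of_ne (ne_of_mem_of_not_mem hi hj)]
    · push Not at hs
      obtain ⟨y, hy, hfy⟩ := hs
      have hay : a j y < 0 := by
        by_contra! hc
        exact absurd (h y fun i hi => by
          rcases Finset.mem_insert.1 hi with rfl | hi
          · exact hc
          · exact hy i hi) (not_le.2 hfy)
      -- With `a j y0 = -1`, the map `x ↦ x + a j x • y0` projects onto the kernel of `a j`. The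
      -- induction hypothesis is applied to the functionals composed with it.
      obtain ⟨y0, hy0, hf0, ha0⟩ : ∃ y0, (∀ i ∈ s, 0 ≤ a i y0) ∧ f y0 < 0 ∧ a j y0 = -1 := by
        have hpos : 0 < (-(a j y))⁻¹ := inv_pos.2 (by linarith)
        refine ⟨(-(a j y))⁻¹ • y, fun i hi => ?_, ?_, ?_⟩
        · rw [map_smul, smul_eq_mul]
          exact mul_nonneg hpos.le (hy i hi)
        · rw [map_smul, smul_eq_mul]
          exact mul_neg_of_pos_of_neg hpos hfy
        · rw [map_smul, smul_eq_mul, inv_neg, neg_mul, inv_mul_cancel₀ hay.ne]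
      obtain ⟨l, hl, hfl⟩ := ih (fun i => a i + a i y0 • a j) (f + f y0 • a j) fun x hx => by
        have := h (x + a j x • y0) fun i hi => by
          rcases Finset.mem_insert.1 hi with rfl | hi
          · simp [ha0]
          · have := hx i hi
            simp only [LinearMap.add_apply, LinearMap.smul_apply, smul_eq_mul] at this
            simp only [map_add, map_smul, smul_eq_mul]
            linarith
        simp only [map_add, map_smul, smul_eq_mul] at this
        simp only [LinearMap.add_apply, LinearMap.smul_apply, smul_eq_mul]
        linarith
      refine ⟨Function.update l j (∑ i ∈ s, l i * a i y0 - f y0), fun i => ?_, ?_⟩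
      · by_cases hi : i = j
        · subst hi
          rw [Function.update_self]
          have : 0 ≤ ∑ i ∈ s, l i * a i y0 :=
            Finset.sum_nonneg fun i hi => mul_nonneg (hl i) (hy0 i hi)
          linarith
        · simpa [hi] using hl i
      · rw [Finset.sum_insert hj, Function.update_self]
        have hupd (c : ℝ) : ∑ i ∈ s, Function.update l j c i • a i = ∑ i ∈ s, l i • a i :=
          Finset.sum_congr rfl fun i hi => by
            rw [Function.update_of_ne (ne_of_mem_of_not_mem hi hj)]
        rw [hupd]
        ext x
        have := congrArg (fun g : V →ₗ[ℝ] ℝ => g x) hfl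
        simp only [LinearMap.add_apply, LinearMap.smul_apply, smul_eq_mul, LinearMap.sum_apply,
          mul_add, Finset.sum_add_distrib] at this
        simp only [LinearMap.add_apply, LinearMap.smul_apply, smul_eq_mul, LinearMap.sum_apply,
          sub_mul, Finset.sum_mul]
        have h2 : ∑ i ∈ s, l i * (a i y0 * (a j) x) = ∑ i ∈ s, l i * a i y0 * (a j) x :=
          Finset.sum_congr rfl fun i _ => by ring
        linarith

/-- **Carathéodory's theorem** for cones: a nonnegative combination can be rewritten as a positive
combination of linearly independent vectors. -/
theorem exists_pos_combination_linearIndepOn {ι V : Type*} [AddCommGroup V] [Module ℝ V]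
    (v : ι → V) (s : Finset ι) (l : ι → ℝ) (hl : ∀ i ∈ s, 0 ≤ l i) :
    ∃ t ⊆ s, ∃ m : ι → ℝ, (∀ i ∈ t, 0 < m i) ∧ ∑ i ∈ t, m i • v i = ∑ i ∈ s, l i • v i ∧
      LinearIndependent ℝ fun i : t => v i := by
  classical
  induction s using Finset.strongInduction generalizing l with
  | H s ih =>
    by_cases hz : ∃ i ∈ s, l i = 0
    · obtain ⟨i, hi, hli⟩ := hz
      obtain ⟨t, ht, m, hm, hsum, hind⟩ := ih (s.erase i) (Finset.erase_ssubset hi) l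
        fun k hk => hl k (Finset.mem_of_mem_erase hk)
      refine ⟨t, ht.trans (Finset.erase_subset _ _), m, hm, ?_, hind⟩
      rw [hsum, ← Finset.add_sum_erase s _ hi, hli, zero_smul, zero_add]
    push Not at hz
    by_cases hind : LinearIndependent ℝ fun i : s => v i
    · exact ⟨s, subset_rfl, l, fun i hi => lt_of_le_of_ne (hl i hi) (hz i hi).symm, rfl, hind⟩
    have : ∃ g : ι → ℝ, ∑ i ∈ s, g i • v i = 0 ∧ ∃ i ∈ s, 0 < g i := by
      rw [Fintype.not_linearIndependent_iff] at hind
      obtain ⟨g, hg, i, hi⟩ := hind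
      let g' : ι → ℝ := fun k => if h : k ∈ s then g ⟨k, h⟩ else 0
      have hg' : ∑ k ∈ s, g' k • v k = 0 := by
        rw [← Finset.sum_coe_sort, ← hg]
        exact Finset.sum_congr rfl fun k _ => by simp [g']
      have hgi : g' i ≠ 0 := by simpa [g'] using hi
      rcases lt_or_gt_of_ne hgi with h | h
      · exact ⟨-g', by simp [hg'], i, i.2, by simpa using h⟩
      · exact ⟨g', hg', i, i.2, h⟩
    obtain ⟨g, hg, i0, hi0, hgi0⟩ := this
    -- Ratio test: `c` is the largest multiple of the relation `g` that can be subtracted with all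
    -- coefficients staying nonnegative. The coefficient at `j` then vanishes.
    obtain ⟨j, hj, hmin⟩ := (s.filter fun i => 0 < g i).exists_min_image (fun i => l i / g i)
      ⟨i0, by simp [hi0, hgi0]⟩
    obtain ⟨hjs, hgj⟩ := Finset.mem_filter.1 hj
    set c := l j / g j with hc
    have hc0 : 0 ≤ c := div_nonneg (hl j hjs) hgj.le
    have hnn : ∀ i ∈ s, 0 ≤ l i - c * g i := fun i hi => by
      rcases le_or_gt (g i) 0 with h | h
      · nlinarith [hl i hi]
      · have := hmin i (by simp [hi, h])
        rw [le_div_iff₀ h] at this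
        linarith
    obtain ⟨t, ht, m, hm, hsum, hind'⟩ := ih (s.erase j) (Finset.erase_ssubset hjs)
      (fun i => l i - c * g i) fun k hk => hnn k (Finset.mem_of_mem_erase hk)
    refine ⟨t, ht.trans (Finset.erase_subset _ _), m, hm, ?_, hind'⟩
    have hlj : l j - c * g j = 0 := by rw [hc]; field_simp; ring
    have h1 : ∑ i ∈ s, (l i - c * g i) • v i = ∑ i ∈ s, l i • v i := by
      simp only [sub_smul, Finset.sum_sub_distrib, mul_smul, ← Finset.smul_sum, hg, smul_zero,
        sub_zero]
    rw [hsum, ← h1, ← Finset.add_sum_erase s _ hjs, hlj, zero_smul, zero_add]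

/-! ### Bases, multipliers and generic costs -/

section LinearProgram

variable {R C : Type*} [Fintype C] {G : Matrix R C ℝ} {p : C → ℝ} {d : R → ℝ} {B : Finset R}

theorem dotProduct_eq_of_vecMul_rowsOf {l : B → ℝ} (hp : l ᵥ* rowsOf G B = p) (z : C → ℝ) :
    p ⬝ᵥ z = ∑ r : B, l r * (G *ᵥ z) r := by
  rw [← hp, ← Matrix.dotProduct_mulVec]
  rfl

theorem IsBasis.eq_of_eqOn (hB : IsBasis G B) {y z : C → ℝ}
    (h : ∀ r ∈ B, (G *ᵥ y) r = (G *ᵥ z) r) : y = z :=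
  hB.1 (funext fun r => h r r.2)

/-- A feasible basic solution with nonnegative multipliers is optimal. -/
theorem isSolution_of_nonneg_multipliers {l : B → ℝ} (hl : ∀ r, 0 ≤ l r)
    (hp : l ᵥ* rowsOf G B = p) {z : C → ℝ} (hz : IsFeasible G d z)
    (hBz : ∀ r ∈ B, (G *ᵥ z) r = d r) : IsSolution G p d z := by
  refine ⟨hz, fun y hy => ?_⟩
  rw [dotProduct_eq_of_vecMul_rowsOf hp, dotProduct_eq_of_vecMul_rowsOf hp]
  refine Finset.sum_le_sum fun r _ => mul_le_mul_of_nonneg_left ?_ (hl r)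
  rw [hBz r r.2]
  exact hy r

/-- A feasible basic solution with positive multipliers is the only optimal point. -/
theorem eq_of_pos_multipliers (hB : IsBasis G B) {l : B → ℝ} (hl : ∀ r, 0 < l r)
    (hp : l ᵥ* rowsOf G B = p) {z : C → ℝ}
    (hBz : ∀ r ∈ B, (G *ᵥ z) r = d r) {y : C → ℝ} (hy : IsFeasible G d y)
    (hyz : p ⬝ᵥ y ≤ p ⬝ᵥ z) : y = z := by
  refine hB.eq_of_eqOn fun r hr => ?_
  have hle : ∀ r ∈ (Finset.univ : Finset B), l r * (G *ᵥ z) r ≤ l r * (G *ᵥ y) r := fun r _ =>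
    mul_le_mul_of_nonneg_left (by rw [hBz r r.2]; exact hy r) (hl r).le
  rw [dotProduct_eq_of_vecMul_rowsOf hp, dotProduct_eq_of_vecMul_rowsOf hp] at hyz
  -- Complementary slackness: equal costs force termwise equality, and a positive multiplier can be
  -- cancelled.
  have := (Finset.sum_eq_sum_iff_of_le hle).1 (le_antisymm (Finset.sum_le_sum hle) hyz) ⟨r, hr⟩
    (Finset.mem_univ _)
  exact (mul_left_cancel₀ (hl ⟨r, hr⟩).ne' this).symm

theorem IsBasis.card_eq (hB : IsBasis G B) : B.card = Fintype.card C := by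
  have e : (C → ℝ) ≃ₗ[ℝ] (B → ℝ) := LinearEquiv.ofBijective (Matrix.mulVecLin (rowsOf G B)) hB
  simpa using e.finrank_eq.symm

theorem IsBasis.vecMul_bijective (hB : IsBasis G B) :
    Function.Bijective (Matrix.vecMulLinear (rowsOf G B)) := by
  have hinj : Function.Injective (Matrix.vecMulLinear (rowsOf G B)) := by
    rw [← LinearMap.ker_eq_bot, LinearMap.ker_eq_bot']
    intro l hl
    obtain ⟨z, hz⟩ : ∃ z, rowsOf G B *ᵥ z = l := hB.2 l
    have hl' : l ᵥ* rowsOf G B = 0 := hl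
    have h0 : l ⬝ᵥ l = 0 := by
      nth_rw 2 [← hz]
      rw [Matrix.dotProduct_mulVec, hl', zero_dotProduct]
    exact dotProduct_self_eq_zero.1 h0
  refine ⟨hinj, (LinearMap.injective_iff_surjective_of_finrank_eq_finrank ?_).1 hinj⟩
  simpa using hB.card_eq

theorem isBasis_of_linearIndependent_of_span_eq_top
    (hB : LinearIndependent ℝ fun r : B => G r)
    (hspan : Submodule.span ℝ (Set.range fun r : B => G r) = ⊤) : IsBasis G B := by
  classical
  have hcard : Module.finrank ℝ (C → ℝ) = Module.finrank ℝ (B → ℝ) := by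
    have := finrank_span_eq_card hB
    rw [hspan, finrank_top] at this
    rw [this, Module.finrank_fintype_fun_eq_card]
  have hinj : Function.Injective (Matrix.mulVecLin (rowsOf G B)) := by
    rw [← LinearMap.ker_eq_bot, LinearMap.ker_eq_bot']
    intro z hz
    have key : ∀ v ∈ Submodule.span ℝ (Set.range fun r : B => G r), v ⬝ᵥ z = 0 := by
      intro v hv
      induction hv using Submodule.span_induction with
      | mem x hx =>
        obtain ⟨r, rfl⟩ := hx
        exact congrFun hz r
      | zero => simp
      | add x y _ _ hx hy => rw [add_dotProduct, hx, hy, add_zero]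
      | smul a x _ hx => rw [smul_dotProduct, hx, smul_zero]
    exact dotProduct_self_eq_zero.1 (key z (by rw [hspan]; trivial))
  exact ⟨hinj, (LinearMap.injective_iff_surjective_of_finrank_eq_finrank hcard).1 hinj⟩

theorem isClosed_setOf_isFeasible (G : Matrix R C ℝ) (d : R → ℝ) :
    IsClosed {z | IsFeasible G d z} := by
  simp only [IsFeasible, Set.ofPred_forall]
  exact isClosed_iInter fun r => isClosed_le continuous_const
    ((continuous_apply r).comp (Matrix.mulVecLin G).continuous_of_finiteDimensional)

theorem exists_isSolution (hbdd : Bornology.IsBounded {z | IsFeasible G d z})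
    (hd : d ∈ admissibleData G) (p : C → ℝ) : ∃ z, IsSolution G p d z := by
  have hcpt : IsCompact {z | IsFeasible G d z} :=
    Metric.isCompact_of_isClosed_isBounded (isClosed_setOf_isFeasible G d) hbdd
  obtain ⟨z, hz, hmin⟩ := hcpt.exists_isMinOn hd
    (f := fun z => p ⬝ᵥ z) (by unfold dotProduct; fun_prop)
  exact ⟨z, hz, fun y hy => hmin hy⟩

variable [Finite R]

/-- First-order optimality: a direction that leaves the active constraints satisfied does not
decrease the cost. -/
theorem IsSolution.dotProduct_nonneg_of_active {z y : C → ℝ} (hz : IsSolution G p d z)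
    (hy : ∀ r, (G *ᵥ z) r = d r → 0 ≤ (G *ᵥ y) r) : 0 ≤ p ⬝ᵥ y := by
  have hev : ∀ᶠ t in nhdsWithin (0 : ℝ) (Set.Ioi 0), IsFeasible G d (z + t • y) := by
    refine Filter.eventually_all.2 fun r => ?_
    simp only [Matrix.mulVec_add, Matrix.mulVec_smul, Pi.add_apply, Pi.smul_apply, smul_eq_mul]
    rcases (hz.1 r).eq_or_lt with h | h
    · filter_upwards [self_mem_nhdsWithin] with t ht
      have := mul_nonneg (le_of_lt ht) (hy r h.symm)
      linarith
    · have hc : ContinuousAt (fun t : ℝ => (G *ᵥ z) r + t * (G *ᵥ y) r) 0 := by fun_prop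
      have := hc.eventually_const_lt (u := d r) (by simpa using h)
      filter_upwards [mem_nhdsWithin_of_mem_nhds this] with t ht
      exact le_of_lt ht
  obtain ⟨t, ht, ht0⟩ := (hev.and self_mem_nhdsWithin).exists
  have := hz.2 _ ht
  rw [dotProduct_add, dotProduct_smul, smul_eq_mul] at this
  exact nonneg_of_mul_nonneg_right (by linarith) ht0

/-- `p` lies in the span of a set of rows of `G` only if these rows span the whole space. -/
def IsGenericCost (G : Matrix R C ℝ) (p : C → ℝ) : Prop :=
  ∀ S : Finset R, p ∈ Submodule.span ℝ (Set.range fun r : S => G r) →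
    Submodule.span ℝ (Set.range fun r : S => G r) = ⊤

/-- A solution for a generic cost is basic, with positive multipliers. -/
theorem IsSolution.exists_basis_of_isGenericCost {z : C → ℝ} (hz : IsSolution G p d z)
    (hp : IsGenericCost G p) : ∃ B : Finset R, IsBasis G B ∧ (∀ r ∈ B, (G *ᵥ z) r = d r) ∧
      ∃ l : B → ℝ, (∀ r, 0 < l r) ∧ l ᵥ* rowsOf G B = p := by
  classical
  have := Fintype.ofFinite R
  let act : Finset R := Finset.univ.filter fun r => (G *ᵥ z) r = d r
  let a : R → (C → ℝ) →ₗ[ℝ] ℝ := fun r => LinearMap.proj r ∘ₗ Matrix.mulVecLin G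
  obtain ⟨l, hl, hpl⟩ := farkas_linear_functionals act a (dotProductBilin ℝ ℝ p) fun y hy => by
    refine hz.dotProduct_nonneg_of_active fun r hr => hy r (by simp [act, hr])
  have hpl' : p = ∑ r ∈ act, l r • G r := by
    refine dotProduct_eq _ _ fun y => ?_
    have := congrArg (fun g : (C → ℝ) →ₗ[ℝ] ℝ => g y) hpl
    simp only [LinearMap.sum_apply, LinearMap.smul_apply] at this
    rw [sum_dotProduct]
    simp only [smul_dotProduct]
    exact this
  -- The independent active rows kept here have `p` in their span, so genericity makes them span
  -- everything: they form a basis.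
  obtain ⟨B, hBact, m, hm, hsum, hind⟩ :=
    exists_pos_combination_linearIndepOn (fun r => G r) act l fun r _ => hl r
  rw [← hpl', ← Finset.sum_coe_sort] at hsum
  refine ⟨B, isBasis_of_linearIndependent_of_span_eq_top hind (hp B ?_), fun r hr => ?_,
    fun r => m r, fun r => hm r r.2, ?_⟩
  · rw [← hsum]
    exact Submodule.sum_mem _ fun r _ => Submodule.smul_mem _ _ (Submodule.subset_span ⟨r, rfl⟩)
  · exact (Finset.mem_filter.1 (hBact hr)).2
  · rw [Matrix.vecMul_eq_sum, ← hsum]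
    rfl

/-- Every cost has a generic perturbation for which no new basis becomes dual feasible. -/
theorem exists_isGenericCost (G : Matrix R C ℝ) (p : C → ℝ) :
    ∃ p', IsGenericCost G p' ∧ ∀ B : Finset R, IsBasis G B →
      (∃ l : B → ℝ, (∀ r, 0 ≤ l r) ∧ l ᵥ* rowsOf G B = p') →
      ∃ l : B → ℝ, (∀ r, 0 ≤ l r) ∧ l ᵥ* rowsOf G B = p := by
  classical
  have := Fintype.ofFinite R
  -- A real vector space is not a finite union of proper subspaces.
  obtain ⟨q, hq⟩ : ∃ q, IsGenericCost G q := by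
    by_contra! hcon
    let W : {S : Finset R // Submodule.span ℝ (Set.range fun r : S => G r) ≠ ⊤} →
      Subspace ℝ (C → ℝ) := fun S => Submodule.span ℝ (Set.range fun r : S.1 => G r)
    obtain ⟨S, hS⟩ := Subspace.exists_eq_top_of_iUnion_eq_univ (p := W) (by
      refine Set.eq_univ_of_forall fun q => ?_
      have := hcon q
      unfold IsGenericCost at this
      push Not at this
      obtain ⟨S, hqS, hS⟩ := this
      exact Set.mem_iUnion.2 ⟨⟨S, hS⟩, hqS⟩)
    exact S.2 hS
  have h1 : ∀ᶠ t in nhdsWithin (0 : ℝ) (Set.Ioi 0), IsGenericCost G (p + t • q) := by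
    refine Filter.eventually_all.2 fun S => ?_
    by_cases hS : Submodule.span ℝ (Set.range fun r : S => G r) = ⊤
    · exact Filter.Eventually.of_forall fun _ _ => hS
    -- Two such parameters would put `q` itself into this proper span.
    have hsub :
        {t : ℝ | p + t • q ∈ Submodule.span ℝ (Set.range fun r : S => G r)}.Subsingleton := by
      intro s hs t ht
      by_contra hst
      have hmem := Submodule.sub_mem (Submodule.span ℝ (Set.range fun r : S => G r)) hs ht
      have hqe : q = (s - t)⁻¹ • (p + s • q - (p + t • q)) := by
        rw [add_sub_add_left_eq_sub, ← sub_smul, smul_smul, inv_mul_cancel₀ (sub_ne_zero.2 hst),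
          one_smul]
      exact hS (hq S (by rw [hqe]; exact Submodule.smul_mem _ _ hmem))
    have hne : ∀ᶠ t in nhdsWithin (0 : ℝ) (Set.Ioi 0),
        t ∉ {t : ℝ | p + t • q ∈ Submodule.span ℝ (Set.range fun r : S => G r)} := by
      rcases hsub.eq_empty_or_singleton with h | ⟨c, h⟩
      · simp [h]
      · rw [h]
        rcases eq_or_ne c 0 with rfl | hc
        · filter_upwards [self_mem_nhdsWithin] with t ht
          exact ne_of_gt ht
        · exact mem_nhdsWithin_of_mem_nhds (isOpen_compl_singleton.mem_nhds (Ne.symm hc))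
    filter_upwards [hne] with t ht h
    exact absurd h ht
  have h2 : ∀ᶠ t in nhdsWithin (0 : ℝ) (Set.Ioi 0), ∀ B : Finset R, IsBasis G B →
      (∃ l : B → ℝ, (∀ r, 0 ≤ l r) ∧ l ᵥ* rowsOf G B = p + t • q) →
      ∃ l : B → ℝ, (∀ r, 0 ≤ l r) ∧ l ᵥ* rowsOf G B = p := by
    refine Filter.eventually_all.2 fun B => ?_
    by_cases hB : IsBasis G B
    swap
    · exact Filter.Eventually.of_forall fun _ h => absurd h hB
    let e := LinearEquiv.ofBijective _ hB.vecMul_bijective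
    by_contra hcon
    have hfr := Filter.not_eventually.1 hcon
    -- If `B` has nonnegative multipliers for arbitrarily small `t`, then by continuity also at `t =
    -- 0`, that is, for `p`.
    have hfr' : ∃ᶠ t in nhds (0 : ℝ), ∀ r, 0 ≤ e.symm (p + t • q) r := by
      refine (hfr.filter_mono nhdsWithin_le_nhds).mono fun t ht => ?_
      push Not at ht
      obtain ⟨-, ⟨l, hl, hlp⟩, -⟩ := ht
      have : e.symm (p + t • q) = l := by
        rw [LinearEquiv.symm_apply_eq]
        exact hlp.symm
      rw [this]
      exact hl
    have hclosed : IsClosed {t : ℝ | ∀ r, 0 ≤ e.symm (p + t • q) r} := by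
      have hcont : Continuous fun t : ℝ => e.symm (p + t • q) :=
        (LinearMap.continuous_of_finiteDimensional e.symm.toLinearMap).comp (by fun_prop)
      simp only [Set.ofPred_forall]
      exact isClosed_iInter fun r => isClosed_le continuous_const ((continuous_apply r).comp hcont)
    have h0 := hclosed.mem_of_frequently_of_tendsto hfr' Filter.tendsto_id
    refine hcon (Filter.Eventually.of_forall fun t _ _ => ⟨e.symm p, ?_, ?_⟩)
    · simpa using h0
    · exact e.apply_symm_apply p
  obtain ⟨t, ht1, ht2⟩ := (h1.and h2).exists
  exact ⟨_, ht1, ht2⟩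

end LinearProgram

/-! ### Decay for block bidiagonal systems -/

section Decay

variable {B C : Type*} [Fintype B] [Fintype C]

/-- The Richardson iteration for `Mᵀ M` with optimal step size is a contraction. -/
theorem richardson_contraction (M : Matrix B C ℝ) {a b : ℝ} (ha : 0 < a) (hab : a ≤ b)
    (hlow : ∀ x, a * (x ⬝ᵥ x) ≤ (M *ᵥ x) ⬝ᵥ (M *ᵥ x))
    (hup : ∀ x, (M *ᵥ x) ⬝ᵥ (M *ᵥ x) ≤ b * (x ⬝ᵥ x)) (x : C → ℝ) :
    (x - (2 / (a + b)) • (Mᵀ *ᵥ (M *ᵥ x))) ⬝ᵥ (x - (2 / (a + b)) • (Mᵀ *ᵥ (M *ᵥ x))) ≤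
      ((b - a) / (b + a)) ^ 2 * (x ⬝ᵥ x) := by
  set c := 2 / (a + b) with hc
  set ρ := (b - a) / (b + a) with hρ
  set y := x - c • (Mᵀ *ᵥ (M *ᵥ x)) with hy
  have hab0 : 0 < a + b := by linarith
  have hc0 : 0 < c := by positivity
  have hρ0 : 0 ≤ ρ := div_nonneg (by linarith) (by linarith)
  -- The step `c` sends the ends `a`, `b` of the spectral interval to `ρ` and `-ρ`, so the form of
  -- `1 - c Mᵀ M` lies between `-ρ` and `ρ` times the squared norm.
  have hca : 1 - c * a = ρ := by rw [hc, hρ, add_comm b a]; field_simp; ring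
  have hcb : 1 - c * b = -ρ := by rw [hc, hρ, add_comm b a]; field_simp; ring
  have hQup (u : C → ℝ) : u ⬝ᵥ u - c * ((M *ᵥ u) ⬝ᵥ (M *ᵥ u)) ≤ ρ * (u ⬝ᵥ u) := by
    rw [← hca]
    nlinarith [mul_le_mul_of_nonneg_left (hlow u) hc0.le]
  have hQlow (u : C → ℝ) : -(ρ * (u ⬝ᵥ u)) ≤ u ⬝ᵥ u - c * ((M *ᵥ u) ⬝ᵥ (M *ᵥ u)) := by
    have := mul_le_mul_of_nonneg_left (hup u) hc0.le
    have h2 : -(ρ * (u ⬝ᵥ u)) = (1 - c * b) * (u ⬝ᵥ u) := by rw [hcb]; ring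
    rw [h2]
    linarith
  have hyy : y ⬝ᵥ y = x ⬝ᵥ y - c * ((M *ᵥ x) ⬝ᵥ (M *ᵥ y)) := by
    have : (Mᵀ *ᵥ (M *ᵥ x)) ⬝ᵥ y = (M *ᵥ x) ⬝ᵥ (M *ᵥ y) := by
      rw [Matrix.mulVec_transpose, ← Matrix.dotProduct_mulVec]
    nth_rw 1 [hy]
    rw [sub_dotProduct, smul_dotProduct, this, smul_eq_mul]
  -- Polarization of that form at `x` and `t • y`, whose mixed term is `y ⬝ᵥ y`. The choice `t =
  -- ρ⁻¹` is optimal; `ρ = 0` is treated apart.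
  have hpol (t : ℝ) : 4 * t * (y ⬝ᵥ y) ≤ 2 * ρ * (x ⬝ᵥ x + t ^ 2 * (y ⬝ᵥ y)) := by
    have h1 := hQup (x + t • y)
    have h2 := hQlow (x - t • y)
    simp only [Matrix.mulVec_add, Matrix.mulVec_sub, Matrix.mulVec_smul, add_dotProduct,
      sub_dotProduct, dotProduct_add, dotProduct_sub, smul_dotProduct, dotProduct_smul,
      smul_eq_mul] at h1 h2
    rw [dotProduct_comm y x, dotProduct_comm (M *ᵥ y) (M *ᵥ x)] at h1 h2
    have h3 : x ⬝ᵥ y = y ⬝ᵥ y + c * ((M *ᵥ x) ⬝ᵥ (M *ᵥ y)) := by rw [hyy]; ring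
    rw [h3] at h1 h2
    linarith
  rcases hρ0.eq_or_lt with h | h
  · have := hpol 1
    rw [← h] at this ⊢
    linarith
  · have h1 := hpol ρ⁻¹
    have h2 := mul_le_mul_of_nonneg_left h1 h.le
    have e1 : ρ * (4 * ρ⁻¹ * (y ⬝ᵥ y)) = 4 * (y ⬝ᵥ y) := by field_simp
    have e2 : ρ * (2 * ρ * (x ⬝ᵥ x + ρ⁻¹ ^ 2 * (y ⬝ᵥ y))) =
        2 * (ρ ^ 2 * (x ⬝ᵥ x)) + 2 * (y ⬝ᵥ y) := by field_simp
    rw [e1, e2] at h2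
    linarith

/-- Iterates of the Richardson method for the normal equations `Mᵀ M y = Mᵀ δ`. -/
def richardsonIterate (M : Matrix B C ℝ) (s : ℝ) (δ : B → ℝ) : ℕ → C → ℝ
  | 0 => 0
  | k + 1 => richardsonIterate M s δ k +
      s • (Mᵀ *ᵥ (δ - M *ᵥ richardsonIterate M s δ k))

/-- `Mᵀ M` couples only neighbouring stages, so each iteration widens the support around `j` by at
most one stage on either side. -/
theorem richardsonIterate_eq_zero (M : Matrix B C ℝ) (s : ℝ) (δ : B → ℝ) {σ : B → ℕ} {τ : C → ℕ}
    (hM : ∀ r c, M r c ≠ 0 → σ r = τ c ∨ σ r = τ c + 1) {j : ℕ} (hδ : ∀ r, δ r ≠ 0 → σ r = j)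
    (k : ℕ) (c : C) (hk : k < ((τ c : ℤ) - j).natAbs) : richardsonIterate M s δ k c = 0 := by
  induction k generalizing c with
  | zero => rfl
  | succ k ih =>
    have hsum : (Mᵀ *ᵥ (δ - M *ᵥ richardsonIterate M s δ k)) c = 0 := by
      refine Finset.sum_eq_zero fun r _ => ?_
      by_cases hr : M r c = 0
      · simp [hr]
      have hrc := hM r c hr
      have h1 : δ r = 0 := by
        by_contra h
        have := hδ r h
        omega
      have h2 : (M *ᵥ richardsonIterate M s δ k) r = 0 := by
        refine Finset.sum_eq_zero fun c' _ => ?_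
        by_cases hr' : M r c' = 0
        · simp [hr']
        have hrc' := hM r c' hr'
        rw [ih c' (by omega), mul_zero]
      simp [h1, h2]
    simp only [richardsonIterate, Pi.add_apply, Pi.smul_apply, hsum, smul_zero, add_zero]
    exact ih c (by omega)

/-- The right-hand side is `M *ᵥ w`, so the error is multiplied by `1 - s Mᵀ M` in each iteration,
starting from `w`. -/
theorem richardsonIterate_error (M : Matrix B C ℝ) {a b : ℝ} (ha : 0 < a) (hab : a ≤ b)
    (hlow : ∀ x, a * (x ⬝ᵥ x) ≤ (M *ᵥ x) ⬝ᵥ (M *ᵥ x))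
    (hup : ∀ x, (M *ᵥ x) ⬝ᵥ (M *ᵥ x) ≤ b * (x ⬝ᵥ x)) (w : C → ℝ) (k : ℕ) :
    (w - richardsonIterate M (2 / (a + b)) (M *ᵥ w) k) ⬝ᵥ
        (w - richardsonIterate M (2 / (a + b)) (M *ᵥ w) k) ≤
      (((b - a) / (b + a)) ^ k) ^ 2 * (w ⬝ᵥ w) := by
  induction k with
  | zero => simp [richardsonIterate]
  | succ k ih =>
    set y := richardsonIterate M (2 / (a + b)) (M *ᵥ w) k with hy
    have he : w - richardsonIterate M (2 / (a + b)) (M *ᵥ w) (k + 1) =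
        (w - y) - (2 / (a + b)) • (Mᵀ *ᵥ (M *ᵥ (w - y))) := by
      rw [richardsonIterate, ← hy, Matrix.mulVec_sub M]
      abel
    rw [he]
    refine (richardson_contraction M ha hab hlow hup (w - y)).trans ?_
    refine (mul_le_mul_of_nonneg_left ih (sq_nonneg _)).trans_eq ?_
    ring

/-- Exponential decay of the inverse of a block bidiagonal matrix: the response `w` to a right-hand
side supported on stage `j` decays with the distance to `j`. -/
theorem sum_sq_le_of_mulVec_supported (M : Matrix B C ℝ) {a b : ℝ} (ha : 0 < a) (hab : a ≤ b)
    (hlow : ∀ x, a * (x ⬝ᵥ x) ≤ (M *ᵥ x) ⬝ᵥ (M *ᵥ x))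
    (hup : ∀ x, (M *ᵥ x) ⬝ᵥ (M *ᵥ x) ≤ b * (x ⬝ᵥ x)) {σ : B → ℕ} {τ : C → ℕ}
    (hM : ∀ r c, M r c ≠ 0 → σ r = τ c ∨ σ r = τ c + 1) (w : C → ℝ) {j : ℕ}
    (hδ : ∀ r, (M *ᵥ w) r ≠ 0 → σ r = j) (i : ℕ) :
    ∑ c with τ c = i, w c ^ 2 ≤
      (((b - a) / (b + a)) ^ (((i : ℤ) - j).natAbs - 1)) ^ 2 * ((M *ᵥ w) ⬝ᵥ (M *ᵥ w) / a) := by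
  -- For `i ≠ j` this is the last iterate certain to vanish at stage `i`. For `i = j` truncated
  -- subtraction gives `k = 0`, where the iterate is zero anyway.
  set k := ((i : ℤ) - j).natAbs - 1 with hk
  set y := richardsonIterate M (2 / (a + b)) (M *ᵥ w) k with hy
  have hw : w ⬝ᵥ w ≤ (M *ᵥ w) ⬝ᵥ (M *ᵥ w) / a := by
    rw [le_div_iff₀ ha, mul_comm]
    exact hlow w
  calc ∑ c with τ c = i, w c ^ 2 = ∑ c with τ c = i, (w - y) c ^ 2 := by
        refine Finset.sum_congr rfl fun c hc => ?_
        have hci : τ c = i := (Finset.mem_filter.1 hc).2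
        have hyc : y c = 0 := by
          rcases Nat.eq_zero_or_pos k with h0 | h0
          · rw [hy, h0]; rfl
          · exact richardsonIterate_eq_zero M _ _ hM hδ k c (by rw [hci]; omega)
        rw [Pi.sub_apply, hyc, sub_zero]
    _ ≤ ∑ c, (w - y) c ^ 2 :=
        Finset.sum_le_sum_of_subset_of_nonneg (Finset.filter_subset _ _) fun _ _ _ => sq_nonneg _
    _ = (w - y) ⬝ᵥ (w - y) := Finset.sum_congr rfl fun c _ => sq _
    _ ≤ (((b - a) / (b + a)) ^ k) ^ 2 * (w ⬝ᵥ w) := richardsonIterate_error M ha hab hlow hup w k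
    _ ≤ _ := mul_le_mul_of_nonneg_left hw (sq_nonneg _)

end Decay

/-! ### Gluing Lipschitz bounds -/

/-- A function on `[0, 1]` that is `K`-Lipschitz on each piece of a finite closed cover satisfies
`‖f 1 - f 0‖ ≤ K`. -/
theorem norm_sub_le_of_finite_closed_cover {ι E : Type*} [Finite ι] [NormedAddCommGroup E]
    {f : ℝ → E} {T : ι → Set ℝ} {K : ℝ} (hT : ∀ i, IsClosed (T i)) (hcov : Set.Icc 0 1 ⊆ ⋃ i, T i)
    (hf : ∀ i, ∀ s ∈ T i, ∀ t ∈ T i, ‖f s - f t‖ ≤ K * |s - t|) : ‖f 1 - f 0‖ ≤ K := by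
  have hcont : ContinuousOn f (Set.Icc 0 1) := by
    refine ((locallyFinite_of_finite T).continuousOn_iUnion hT fun i => ?_).mono hcov
    have hlip : LipschitzOnWith K.toNNReal f (T i) := by
      refine LipschitzOnWith.of_dist_le_mul fun s hs t ht => ?_
      rw [dist_eq_norm, Real.dist_eq]
      exact (hf i s hs t ht).trans
        (mul_le_mul_of_nonneg_right (Real.le_coe_toNNReal K) (abs_nonneg _))
    exact hlip.continuousOn
  have key := image_le_of_liminf_slope_right_le_deriv_boundary (f := fun s => ‖f s - f 0‖)
    (B := fun s => K * s) (B' := fun _ => K) (a := 0) (b := 1) (by fun_prop) (by simp)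
    (by fun_prop) (fun x _ => by simpa using ((hasDerivAt_id x).const_mul K).hasDerivWithinAt)
    ?_ (Set.right_mem_Icc.2 zero_le_one)
  · simpa using key
  intro x hx r hr
  have hev : ∀ᶠ z in nhdsWithin x (Set.Ioi x), ∃ i, z ∈ T i := by
    filter_upwards [Ioo_mem_nhdsGT hx.2] with z hz
    exact Set.mem_iUnion.1 (hcov ⟨hx.1.trans hz.1.le, hz.2.le⟩)
  -- Pigeonhole: one piece contains points arbitrarily close to the right of `x`, and, being closed,
  -- `x` itself. This bounds the lower right slope at `x` by `K`.
  obtain ⟨i, hi⟩ : ∃ i, ∃ᶠ z in nhdsWithin x (Set.Ioi x), z ∈ T i := by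
    by_contra! hcon
    obtain ⟨z, ⟨i, hzi⟩, hz⟩ := (hev.and (Filter.eventually_all.2 hcon)).exists
    exact hz i hzi
  have hxi : x ∈ T i := (hT i).mem_of_frequently_of_tendsto
    (hi.filter_mono nhdsWithin_le_nhds) Filter.tendsto_id
  refine (hi.and_eventually self_mem_nhdsWithin).mono fun z hz => ?_
  obtain ⟨hzi, hzx⟩ := hz
  have hzx' : 0 < z - x := sub_pos.2 hzx
  refine lt_of_le_of_lt ?_ hr
  rw [slope_def_field, div_le_iff₀ hzx']
  have h1 := hf i z hzi x hxi
  rw [abs_of_pos hzx'] at h1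
  have h2 : ‖f z - f 0‖ ≤ ‖f z - f x‖ + ‖f x - f 0‖ := norm_sub_le_norm_sub_add_norm_sub _ _ _
  linarith

/-! ### From basic solutions to optimal solutions -/

section Sensitivity

variable {R C : Type*} [Finite R] [Fintype C] {G : Matrix R C ℝ}

/-- A bound on the response of every basic solution to a change of the data carries over to a
selection of optimal solutions. -/
theorem exists_isSolution_sub_le_of_basis_bound {I E : Type*} [NormedAddCommGroup E]
    (hbdd : ∀ d, Bornology.IsBounded {z | IsFeasible G d z}) (p : C → ℝ)
    (ν : I → (C → ℝ) → E) (κ : I → (R → ℝ) → ℝ) (hν : ∀ i y z, ν i y - ν i z = ν i (y - z))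
    (hκ : ∀ i (t : ℝ) d, κ i (t • d) = κ i d * |t|)
    (hB : ∀ B, IsBasis G B → ∀ w δ, (∀ r ∈ B, (G *ᵥ w) r = δ r) → ∀ i, ‖ν i w‖ ≤ κ i δ)
    {d d' : R → ℝ} (hd : d ∈ admissibleData G) (hd' : d' ∈ admissibleData G) :
    ∃ z z', IsSolution G p d z ∧ IsSolution G p d' z' ∧ ∀ i, ‖ν i z - ν i z'‖ ≤ κ i (d - d') := by
  obtain ⟨p', hgen, hpp'⟩ := exists_isGenericCost G p
  -- Optimality passes from `p'` to `p` because the same basis carries nonnegative multipliers for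
  -- `p`.
  have hsol (δ : R → ℝ) (z : C → ℝ) (hz : IsSolution G p' δ z) : IsSolution G p δ z := by
    obtain ⟨B, hBas, hBz, l, hl, hlp⟩ := hz.exists_basis_of_isGenericCost hgen
    obtain ⟨m, hm, hmp⟩ := hpp' B hBas ⟨l, fun r => (hl r).le, hlp⟩
    exact isSolution_of_nonneg_multipliers hm hmp hz.1 hBz
  let D : ℝ → R → ℝ := fun s => d' + s • (d - d')
  have hD0 : D 0 = d' := by simp [D]
  have hD1 : D 1 = d := by simp [D]
  have hadm : ∀ s ∈ Set.Icc (0 : ℝ) 1, D s ∈ admissibleData G := by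
    rintro s ⟨h0, h1⟩
    obtain ⟨z, hz⟩ := hd
    obtain ⟨z', hz'⟩ := hd'
    refine ⟨z' + s • (z - z'), fun r => ?_⟩
    simp only [D, Matrix.mulVec_add, Matrix.mulVec_smul, Matrix.mulVec_sub, Pi.add_apply,
      Pi.smul_apply, Pi.sub_apply, smul_eq_mul]
    nlinarith [mul_le_mul_of_nonneg_left (hz r) h0,
      mul_le_mul_of_nonneg_left (hz' r) (sub_nonneg.2 h1)]
  have hex : ∀ s, ∃ z, s ∈ Set.Icc (0 : ℝ) 1 → IsSolution G p' (D s) z := fun s => by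
    by_cases hs : s ∈ Set.Icc (0 : ℝ) 1
    · obtain ⟨z, hz⟩ := exists_isSolution (hbdd (D s)) (hadm s hs) p'
      exact ⟨z, fun _ => hz⟩
    · exact ⟨0, fun h => absurd h hs⟩
  choose z hz using hex
  refine ⟨z 1, z 0, hD1 ▸ hsol _ _ (hz 1 (by simp)), hD0 ▸ hsol _ _ (hz 0 (by simp)), fun i => ?_⟩
  -- `T B` collects the parameters whose basic solution for `B` is feasible. Positive multipliers
  -- make that point the unique `p'`-optimum, hence equal to `z s`.
  let T : {B : Finset R // IsBasis G B ∧ ∃ l : B → ℝ, (∀ r, 0 < l r) ∧ l ᵥ* rowsOf G B = p'} →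
    Set ℝ := fun B => {s | s ∈ Set.Icc (0 : ℝ) 1 ∧
      IsFeasible G (D s)
        ((LinearEquiv.ofBijective (Matrix.mulVecLin (rowsOf G B.1)) B.2.1).symm fun r => D s r)}
  have hTz : ∀ B, ∀ s ∈ T B, ∀ r ∈ B.1, (G *ᵥ z s) r = D s r := by
    rintro ⟨B, hBas, l, hl, hlp⟩ s ⟨hs, hfeas⟩ r hr
    set e := LinearEquiv.ofBijective (Matrix.mulVecLin (rowsOf G B)) hBas
    have hbasic : ∀ r ∈ B, (G *ᵥ (e.symm fun r => D s r)) r = D s r := fun r hr =>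
      congrFun (e.apply_symm_apply fun r : B => D s r) ⟨r, hr⟩
    rw [eq_of_pos_multipliers hBas hl hlp hbasic (hz s hs).1 ((hz s hs).2 _ hfeas)]
    exact hbasic r hr
  refine norm_sub_le_of_finite_closed_cover (f := fun s => ν i (z s)) (T := T) ?_ ?_ ?_
  · rintro ⟨B, hBas, hl⟩
    set e := LinearEquiv.ofBijective (Matrix.mulVecLin (rowsOf G B)) hBas with he
    have hcont : Continuous fun s : ℝ => G *ᵥ (e.symm fun r => D s r) :=
      (LinearMap.continuous_of_finiteDimensional
        (Matrix.mulVecLin G ∘ₗ e.symm.toLinearMap)).comp (by fun_prop)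
    refine isClosed_Icc.inter ?_
    change IsClosed {s | ∀ r, D s r ≤ (G *ᵥ (e.symm fun r => D s r)) r}
    simp only [Set.ofPred_forall]
    exact isClosed_iInter fun r =>
      isClosed_le (by fun_prop) ((continuous_apply r).comp hcont)
  · intro s hs
    obtain ⟨B, hBas, hBz, l, hl, hlp⟩ := (hz s hs).exists_basis_of_isGenericCost hgen
    refine Set.mem_iUnion.2 ⟨⟨B, hBas, l, hl, hlp⟩, hs, ?_⟩
    have hzs : ((LinearEquiv.ofBijective (Matrix.mulVecLin (rowsOf G B)) hBas).symm
        fun r => D s r) = z s := by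
      rw [LinearEquiv.symm_apply_eq]
      exact funext fun r => (hBz r r.2).symm
    rw [hzs]
    exact (hz s hs).1
  -- On one piece the difference `z s - z t` is the response of a single basis to the data change
  -- `(s - t) • (d - d')`.
  · intro B s hs t ht
    rw [hν, ← hκ]
    refine hB B.1 B.2.1 _ _ (fun r hr => ?_) i
    rw [Matrix.mulVec_sub, Pi.sub_apply, hTz B s hs r hr, hTz B t ht r hr]
    simp only [D, Pi.add_apply, Pi.smul_apply, smul_eq_mul]
    ring

end Sensitivity

/-! ### Extreme singular values as norm bounds -/

section SingularValues

open InnerProductSpace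

/-- In an orthonormal eigenbasis of `T* T` the form `‖T x‖ ^ 2` is diagonal, so the bounds by the
extreme singular values can be checked termwise. -/
theorem norm_sq_apply_eq_sum_singularValues {E F : Type*} [NormedAddCommGroup E]
    [InnerProductSpace ℝ E] [FiniteDimensional ℝ E] [NormedAddCommGroup F] [InnerProductSpace ℝ F]
    [FiniteDimensional ℝ F] (T : E →ₗ[ℝ] F) (x : E) :
    ‖T x‖ ^ 2 = ∑ i : Fin (Module.finrank ℝ E), T.singularValues i ^ 2 *
      (T.isSymmetric_adjoint_comp_self.eigenvectorBasis rfl).repr x i ^ 2 := by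
  set b := T.isSymmetric_adjoint_comp_self.eigenvectorBasis rfl with hb
  rw [← real_inner_self_eq_norm_sq, ← LinearMap.adjoint_inner_left, ← LinearMap.comp_apply,
    ← b.repr.inner_map_map, PiLp.inner_apply]
  refine Finset.sum_congr rfl fun i _ => ?_
  rw [hb, LinearMap.IsSymmetric.eigenvectorBasis_apply_self_apply, T.sq_singularValues_fin rfl]
  simp only [RCLike.ofReal_real_eq_id, id_eq, RCLike.inner_apply, conj_trivial]
  ring

theorem dotProduct_self_eq_norm_sq {ι : Type*} [Fintype ι] (x : ι → ℝ) :
    x ⬝ᵥ x = ‖WithLp.toLp 2 x‖ ^ 2 := by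
  rw [EuclideanSpace.real_norm_sq_eq]
  exact Finset.sum_congr rfl fun i _ => (sq _).symm

theorem sigmaMin_pos {R C : Type*} [Fintype C] [DecidableEq C] [Nonempty C]
    {G : Matrix R C ℝ} {B : Finset R} (hB : IsBasis G B) :
    0 < sigmaMin (rowsOf G B) := by
  have hinj : Function.Injective (Matrix.toEuclideanLin (rowsOf G B)) := fun x y hxy =>
    WithLp.ofLp_injective 2 (hB.1 (congrArg WithLp.ofLp hxy))
  refine (LinearMap.injective_iff_forall_lt_finrank_singularValues_pos _).1 hinj _ ?_
  rw [finrank_euclideanSpace]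
  exact Nat.sub_lt Fintype.card_pos one_pos

variable {R C : Type*} [Fintype R] [Fintype C] [DecidableEq C] (M : Matrix R C ℝ)

theorem sigmaMin_sq_mul_le (x : C → ℝ) :
    sigmaMin M ^ 2 * (x ⬝ᵥ x) ≤ (M *ᵥ x) ⬝ᵥ (M *ᵥ x) := by
  set T := Matrix.toEuclideanLin M with hT
  have hMx : (M *ᵥ x) ⬝ᵥ (M *ᵥ x) = ‖T (WithLp.toLp 2 x)‖ ^ 2 := by
    rw [dotProduct_self_eq_norm_sq]
    rfl
  rw [hMx, norm_sq_apply_eq_sum_singularValues, dotProduct_self_eq_norm_sq,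
    ← (T.isSymmetric_adjoint_comp_self.eigenvectorBasis rfl).repr.norm_map,
    EuclideanSpace.real_norm_sq_eq, Finset.mul_sum]
  refine Finset.sum_le_sum fun i _ => mul_le_mul_of_nonneg_right ?_ (sq_nonneg _)
  refine pow_le_pow_left₀ (T.singularValues_nonneg _) (T.singularValues_antitone ?_) 2
  have hi : (i : ℕ) < Fintype.card C := i.2.trans_eq finrank_euclideanSpace
  omega

theorem le_sigmaMax_sq_mul (x : C → ℝ) :
    (M *ᵥ x) ⬝ᵥ (M *ᵥ x) ≤ sigmaMax M ^ 2 * (x ⬝ᵥ x) := by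
  set T := Matrix.toEuclideanLin M with hT
  have hMx : (M *ᵥ x) ⬝ᵥ (M *ᵥ x) = ‖T (WithLp.toLp 2 x)‖ ^ 2 := by
    rw [dotProduct_self_eq_norm_sq]
    rfl
  rw [hMx, norm_sq_apply_eq_sum_singularValues, dotProduct_self_eq_norm_sq,
    ← (T.isSymmetric_adjoint_comp_self.eigenvectorBasis rfl).repr.norm_map,
    EuclideanSpace.real_norm_sq_eq, Finset.mul_sum]
  refine Finset.sum_le_sum fun i _ => mul_le_mul_of_nonneg_right ?_ (sq_nonneg _)
  exact pow_le_pow_left₀ (T.singularValues_nonneg _) (T.singularValues_antitone (Nat.zero_le _)) 2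

theorem sigmaMin_le_sigmaMax : sigmaMin M ≤ sigmaMax M :=
  LinearMap.singularValues_antitone _ (Nat.zero_le _)

end SingularValues

/-! ### Stagewise response of a basis -/

section Stages

variable {N : ℕ} {ρ κ : Type*} [Fintype ρ] [Fintype κ]

theorem norm_stage_sq (v : Fin N × κ → ℝ) (i : Fin N) :
    ‖stage v i‖ ^ 2 = ∑ c : Fin N × κ with (c.1 : ℕ) = i, v c ^ 2 := by
  rw [EuclideanSpace.real_norm_sq_eq, Finset.sum_filter, Fintype.sum_prod_type,
    Finset.sum_eq_single i]
  · simp [stage]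
  · intro j _ hj
    simp [Fin.val_ne_of_ne hj]
  · simp

/-- The response of a basic solution to a change `δ` of the data decays exponentially with the
distance of the stages. -/
theorem norm_stage_le_of_isBasis [DecidableEq κ] {G : Matrix (Fin N × ρ) (Fin N × κ) ℝ}
    (hG : ∀ r c, G r c ≠ 0 → (r.1 : ℕ) = c.1 ∨ (r.1 : ℕ) = c.1 + 1)
    {B : Finset (Fin N × ρ)} (hB : IsBasis G B) {a b : ℝ} (ha : 0 < a)
    (hab : a ≤ b) (hmin : a ≤ sigmaMin (rowsOf G B)) (hmax : sigmaMax (rowsOf G B) ≤ b)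
    {w : Fin N × κ → ℝ} {δ : Fin N × ρ → ℝ} (hw : ∀ r ∈ B, (G *ᵥ w) r = δ r) (i : Fin N) :
    ‖stage w i‖ ≤ ∑ j : Fin N, b / a ^ 2 *
      ((b ^ 2 - a ^ 2) / (b ^ 2 + a ^ 2)) ^ (((i : ℤ) - (j : ℤ)).natAbs - 1) * ‖stage δ j‖ := by
  classical
  set M := rowsOf G B with hM
  have hb : 0 < b := ha.trans_le hab
  have hab2 : a ^ 2 ≤ b ^ 2 := pow_le_pow_left₀ ha.le hab 2
  have hρ : 0 ≤ (b ^ 2 - a ^ 2) / (b ^ 2 + a ^ 2) := div_nonneg (sub_nonneg.2 hab2) (by positivity)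
  have hself (x : Fin N × κ → ℝ) : 0 ≤ x ⬝ᵥ x := Finset.sum_nonneg fun c _ => mul_self_nonneg _
  have hlow (x : Fin N × κ → ℝ) : a ^ 2 * (x ⬝ᵥ x) ≤ (M *ᵥ x) ⬝ᵥ (M *ᵥ x) :=
    (mul_le_mul_of_nonneg_right (pow_le_pow_left₀ ha.le hmin 2) (hself x)).trans
      (sigmaMin_sq_mul_le M x)
  have hup (x : Fin N × κ → ℝ) : (M *ᵥ x) ⬝ᵥ (M *ᵥ x) ≤ b ^ 2 * (x ⬝ᵥ x) :=
    (le_sigmaMax_sq_mul M x).trans (mul_le_mul_of_nonneg_right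
      (pow_le_pow_left₀ (LinearMap.singularValues_nonneg _ _) hmax 2) (hself x))
  let e := LinearEquiv.ofBijective (Matrix.mulVecLin M) hB
  -- Superposition: the data change is split by stages, and the decay estimate is applied to each
  -- part.
  let δB : Fin N → B → ℝ := fun j r => if r.1.1 = j then δ r else 0
  have hMe (j : Fin N) : M *ᵥ (e.symm (δB j)) = δB j := e.apply_symm_apply _
  have hsum : w = ∑ j, e.symm (δB j) := by
    rw [← map_sum, LinearEquiv.eq_symm_apply]
    ext r
    have hwr : e w r = δ r := hw r r.2
    rw [hwr, Finset.sum_apply]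
    simp [δB]
  have hδB (j : Fin N) : δB j ⬝ᵥ δB j ≤ ‖stage δ j‖ ^ 2 := by
    have h1 : δB j ⬝ᵥ δB j = ∑ r ∈ B, if (r.1 : ℕ) = j then δ r ^ 2 else 0 := by
      rw [← Finset.sum_coe_sort B]
      refine Finset.sum_congr rfl fun r _ => ?_
      by_cases hr : r.1.1 = j
      · simp [δB, hr, sq]
      · simp [δB, hr, Fin.val_ne_of_ne hr]
    rw [h1, norm_stage_sq, Finset.sum_filter]
    refine Finset.sum_le_sum_of_subset_of_nonneg (Finset.subset_univ _) fun r _ _ => ?_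
    split_ifs <;> positivity
  have hstage (j : Fin N) : ‖stage (e.symm (δB j)) i‖ ≤ b / a ^ 2 *
      ((b ^ 2 - a ^ 2) / (b ^ 2 + a ^ 2)) ^ (((i : ℤ) - (j : ℤ)).natAbs - 1) * ‖stage δ j‖ := by
    have key := sum_sq_le_of_mulVec_supported M (pow_pos ha 2) hab2 hlow hup
      (σ := fun r => r.1.1) (τ := fun c => c.1) (fun r c => hG r c) (e.symm (δB j)) (j := j)
      (fun r hr => by
        rw [hMe] at hr
        by_contra hne
        exact hr (if_neg fun h => hne (congrArg Fin.val h))) i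
    rw [← norm_stage_sq, hMe] at key
    refine le_of_sq_le_sq (key.trans ?_) (by positivity)
    rw [mul_comm (b / a ^ 2), mul_assoc, mul_pow]
    refine mul_le_mul_of_nonneg_left ?_ (sq_nonneg _)
    rw [mul_pow, div_eq_inv_mul]
    refine mul_le_mul ?_ (hδB j) (Finset.sum_nonneg fun r _ => mul_self_nonneg _) (sq_nonneg _)
    -- The decay estimate yields the factor `1 / a`; it is at most `b / a ^ 2` because `a ≤ b`.
    rw [div_pow, inv_eq_one_div, div_le_div_iff₀ (by positivity) (by positivity)]
    nlinarith [mul_le_mul_of_nonneg_right hab2 (sq_nonneg a)]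
  have hst : stage w i = ∑ j, stage (e.symm (δB j)) i := by
    ext k
    have := congrFun hsum (i, k)
    rw [Finset.sum_apply] at this
    simpa [stage] using this
  rw [hst]
  exact (norm_sum_le _ _).trans (Finset.sum_le_sum fun j _ => hstage j)

end Stages

/-! ### Band structure and box constraints of the MPC matrix -/

section MPC

variable {N nx nu nw : ℕ} (A : Fin N → Matrix (Fin nx) (Fin nx) ℝ)
  (B : Fin N → Matrix (Fin nx) (Fin nu) ℝ) (E : Fin N → Matrix (Fin nw) (Fin nx) ℝ)
  (F : Fin N → Matrix (Fin nw) (Fin nu) ℝ)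

theorem stage_eq_or_of_mpcMatrix_ne_zero (r : Fin N × StageRow nx nu nw)
    (c : Fin N × StageCol nx nu) (h : mpcMatrix A B E F r c ≠ 0) :
    (r.1 : ℕ) = c.1 ∨ (r.1 : ℕ) = c.1 + 1 := by
  by_contra! hcon
  refine h ?_
  rw [mpcMatrix, Matrix.of_apply, if_neg fun h => hcon.1 (congrArg Fin.val h), if_neg hcon.2]

/-- The lower and upper bounds that the last four blocks of rows impose on the variables. -/
theorem bounds_of_isFeasible_mpcMatrix {d : Fin N × StageRow nx nu nw → ℝ}
    {z : Fin N × StageCol nx nu → ℝ} (hz : IsFeasible (mpcMatrix A B E F) d z) :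
    ∀ c : Fin N × StageCol nx nu, (match c with
      | (i, .inl k) => d (i, .inr (.inr (.inr (.inr (.inl k)))))
      | (i, .inr k) => d (i, .inr (.inr (.inr (.inr (.inr (.inr (.inl k)))))))) ≤ z c ∧
      z c ≤ (match c with
      | (i, .inl k) => -d (i, .inr (.inr (.inr (.inr (.inr (.inl k))))))
      | (i, .inr k) => -d (i, .inr (.inr (.inr (.inr (.inr (.inr (.inr k)))))))) := by
  have hrow (r : Fin N × StageRow nx nu nw) (c : Fin N × StageCol nx nu) (s : ℝ)
      (h : mpcMatrix A B E F r = Pi.single c s) : d r ≤ s * z c := by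
    have := hz r
    rwa [Matrix.mulVec, h, single_dotProduct] at this
  rintro ⟨i, k | k⟩
  · constructor
    · simpa using hrow (i, .inr (.inr (.inr (.inr (.inl k))))) (i, .inl k) 1 (by
        ext ⟨i', k' | k'⟩ <;> by_cases hi : i = i' <;>
          simp [mpcMatrix, diagBlock, subdiagBlock, Pi.single_apply, Matrix.one_apply, hi, eq_comm])
    · refine le_neg_of_le_neg ?_
      simpa using hrow (i, .inr (.inr (.inr (.inr (.inr (.inl k)))))) (i, .inl k) (-1) (by
        ext ⟨i', k' | k'⟩ <;> by_cases hi : i = i' <;>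
          simp [mpcMatrix, diagBlock, subdiagBlock, Pi.single_apply, Matrix.one_apply, hi, eq_comm]
        split_ifs <;> simp)
  · constructor
    · simpa using hrow (i, .inr (.inr (.inr (.inr (.inr (.inr (.inl k))))))) (i, .inr k) 1 (by
        ext ⟨i', k' | k'⟩ <;> by_cases hi : i = i' <;>
          simp [mpcMatrix, diagBlock, subdiagBlock, Pi.single_apply, Matrix.one_apply, hi, eq_comm])
    · refine le_neg_of_le_neg ?_
      simpa using hrow (i, .inr (.inr (.inr (.inr (.inr (.inr (.inr k))))))) (i, .inr k) (-1) (by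
        ext ⟨i', k' | k'⟩ <;> by_cases hi : i = i' <;>
          simp [mpcMatrix, diagBlock, subdiagBlock, Pi.single_apply, Matrix.one_apply, hi, eq_comm]
        split_ifs <;> simp)

/-- Compactness of the feasible set guarantees a solution for every cost, in particular for the
perturbed one. -/
theorem isBounded_setOf_isFeasible_mpcMatrix (d : Fin N × StageRow nx nu nw → ℝ) :
    Bornology.IsBounded {z | IsFeasible (mpcMatrix A B E F) d z} :=
  (Metric.isBounded_Icc _ _).subset fun _ hz =>
    ⟨fun c => (bounds_of_isFeasible_mpcMatrix A B E F hz c).1,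
      fun c => (bounds_of_isFeasible_mpcMatrix A B E F hz c).2⟩

theorem eq_zero_of_isFeasible_mpcMatrix_zero {z : Fin N × StageCol nx nu → ℝ}
    (hz : IsFeasible (mpcMatrix A B E F) 0 z) : z = 0 := by
  ext ⟨i, k | k⟩
  all_goals
    have := bounds_of_isFeasible_mpcMatrix A B E F hz
  · simpa using le_antisymm (by simpa using (this (i, .inl k)).2) (this (i, .inl k)).1
  · simpa using le_antisymm (by simpa using (this (i, .inr k)).2) (this (i, .inr k)).1

end MPC

/-! ### All bases are optimal for some data; conclusion -/

/-- If `0` is the only feasible point for zero data, then every basis is optimal for zero data. -/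
theorem optimalBases_eq_setOf_isBasis {R C : Type*} [Fintype C] {G : Matrix R C ℝ}
    (h : ∀ z, IsFeasible G 0 z → z = 0) (p : C → ℝ) : optimalBases G p = {B | IsBasis G B} := by
  have h0 : IsFeasible G 0 0 := fun r => by simp
  refine Set.Subset.antisymm (fun B ⟨_, _, hB⟩ => hB.1) fun B hB => ?_
  refine ⟨0, ⟨0, h0⟩, hB, 0, fun r => by simp, h0, fun y hy => ?_⟩
  rw [h y hy]

theorem theorem3 {N nx nu nw : ℕ} (hN : 0 < N) (hn : 0 < nx + nu)
    (A : Fin N → Matrix (Fin nx) (Fin nx) ℝ) (B : Fin N → Matrix (Fin nx) (Fin nu) ℝ)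
    (E : Fin N → Matrix (Fin nw) (Fin nx) ℝ) (F : Fin N → Matrix (Fin nw) (Fin nu) ℝ)
    (p : Fin N × StageCol nx nu → ℝ)
    (G : Matrix (Fin N × StageRow nx nu nw) (Fin N × StageCol nx nu) ℝ)
    (hG : G = mpcMatrix A B E F) :
    -- the minimum and the maximum that enter the constants exist, and the former is positive
    IsLeast ((fun S => sigmaMin (rowsOf G S)) '' optimalBases G p) (sigmaLower G p) ∧
    IsGreatest ((fun S => sigmaMax (rowsOf G S)) '' optimalBases G p) (sigmaUpper G p) ∧
    0 < sigmaLower G p ∧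
    ∀ d ∈ admissibleData G, ∀ d' ∈ admissibleData G,
      ∃ z z' : Fin N × StageCol nx nu → ℝ, IsSolution G p d z ∧ IsSolution G p d' z' ∧
        ∀ i : Fin N, ‖stage z i - stage z' i‖ ≤
          ∑ j : Fin N, sensConst G p * sensRate G p ^ (((i : ℤ) - (j : ℤ)).natAbs - 1) *
            ‖stage d j - stage d' j‖ := by
  have hbdd : ∀ d, Bornology.IsBounded {z | IsFeasible G d z} := by
    rw [hG]
    exact isBounded_setOf_isFeasible_mpcMatrix A B E F
  have hzero : ∀ z, IsFeasible G 0 z → z = 0 := by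
    rw [hG]
    exact fun z hz => eq_zero_of_isFeasible_mpcMatrix_zero A B E F hz
  have hband : ∀ r c, G r c ≠ 0 → (r.1 : ℕ) = c.1 ∨ (r.1 : ℕ) = c.1 + 1 := by
    rw [hG]
    exact stage_eq_or_of_mpcMatrix_ne_zero A B E F
  -- Hence `sigmaLower` and `sigmaUpper` bound the singular values of every basis, which the basis
  -- bound used below requires.
  have hopt := optimalBases_eq_setOf_isBasis hzero p
  have : Nonempty (Fin N × StageCol nx nu) := by
    have : Nonempty (Fin N) := ⟨⟨0, hN⟩⟩
    have : Nonempty (StageCol nx nu) := Fintype.card_pos_iff.1 (by simpa using hn)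
    infer_instance
  have hne : (optimalBases G p).Nonempty := by
    rw [hopt]
    -- A basis exists because a solution for a generic cost, here with zero data, is basic.
    obtain ⟨p', hgen, -⟩ := exists_isGenericCost G p
    obtain ⟨z, hz⟩ := exists_isSolution (hbdd 0) ⟨0, fun r => by simp⟩ p'
    obtain ⟨S, hS, -⟩ := hz.exists_basis_of_isGenericCost hgen
    exact ⟨S, hS⟩
  have hfin : (optimalBases G p).Finite := Set.toFinite _
  have hleast : IsLeast ((fun S => sigmaMin (rowsOf G S)) '' optimalBases G p) (sigmaLower G p) :=
    ⟨(hne.image _).csInf_mem (hfin.image _), fun _ hx => csInf_le (hfin.image _).bddBelow hx⟩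
  have hgreatest :
      IsGreatest ((fun S => sigmaMax (rowsOf G S)) '' optimalBases G p) (sigmaUpper G p) :=
    ⟨(hne.image _).csSup_mem (hfin.image _), fun _ hx => le_csSup (hfin.image _).bddAbove hx⟩
  have hmin : ∀ S, IsBasis G S → sigmaLower G p ≤ sigmaMin (rowsOf G S) := fun S hS =>
    hleast.2 ⟨S, by rwa [hopt], rfl⟩
  have hmax : ∀ S, IsBasis G S → sigmaMax (rowsOf G S) ≤ sigmaUpper G p := fun S hS =>
    hgreatest.2 ⟨S, by rwa [hopt], rfl⟩
  obtain ⟨S, hS, hSeq⟩ := hleast.1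
  rw [hopt] at hS
  have hpos : 0 < sigmaLower G p := hSeq ▸ sigmaMin_pos hS
  have hle : sigmaLower G p ≤ sigmaUpper G p :=
    (hmin S hS).trans ((sigmaMin_le_sigmaMax _).trans (hmax S hS))
  refine ⟨hleast, hgreatest, hpos, fun d hd d' hd' => ?_⟩
  refine exists_isSolution_sub_le_of_basis_bound hbdd p (fun i z => stage z i)
    (fun i δ => ∑ j : Fin N, sensConst G p * sensRate G p ^ (((i : ℤ) - (j : ℤ)).natAbs - 1) *
      ‖stage δ j‖) (fun _ _ _ => rfl) (fun i t δ => ?_)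
    (fun S hS w δ hw i =>
      norm_stage_le_of_isBasis hband hS hpos hle (hmin S hS) (hmax S hS) hw i) hd hd'
  rw [Finset.sum_mul]
  refine Finset.sum_congr rfl fun j _ => ?_
  have : stage (t • δ) j = t • stage δ j := rfl
  rw [this, norm_smul, Real.norm_eq_abs]
  ring
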